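/- Let $d\ge 1$. For an integer $n\ge 1$ and positive integers $g_1,\dots,g_m$, let $C_n^{g_1,\dots,g_m}$ be the $2m$-regular circulant multigraph with vertex set $\mathbb{Z}/n\mathbb{Z}$ that has, for every vertex $v$ and every $i\in\{1,\dots,m\}$, one edge joining $v$ and $v+g_i$ (so that every $v$ is joined to $v\pm g_i$ mod $n$, with multiplicity). Let $\tau(G)$ be the number of spanning trees of $G$. The tree entropy of a sequence of graphs $G_n$ is the limit $\lim_{n\to\infty}\log\tau(G_n)/|V(G_n)|$, if it exists. Let $\gamma_1,\dots,\gamma_d$ be positive integers. Then the tree entropy $z_F(1,\gamma_1,\dots,\gamma_d)$ of the circulant graphs with fixed generators $C_n^{1,\gamma_1,\dots,\gamma_d}$, as $n\to\infty$, exists, and there is an integer $B\ge 2$ such that for every integer $\beta\ge B$ the tree entropy $z_{NF}(\beta;1,\gamma_1,\dots,\gamma_{d-1})$ of the circulant graphs with non-fixed generators $C_{\beta n}^{1,n,\gamma_1 n,\dots,\gamma_{d-1}n}$, as $n\to\infty$ with $\beta$ fixed, exists and $$z_{NF}(\beta;1,\gamma_1,\dots,\gamma_{d-1})>z_F(1,\gamma_1,\dots,\gamma_d).$$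 -/

import Mathlib

/-- The number `τ(G)` of spanning trees of a multigraph `G`: the number of spanning subgraphs of `G`
that are connected and have no cycle. Loops and pairs of parallel edges are cycles, so a spanning
tree is a spanning subgraph that is simple (no loops, no parallel edges) and whose simple graph is
a tree. Subgraphs with different sets of (labelled) edges are different. -/
noncomputable def spanningTreeCount {V E : Type*} (G : Graph V E) : ℕ :=
  {T : Graph V E | T ≤s G ∧ T.Simple ∧ T.toSimpleGraph.IsTree}.ncard

/-- The circulant graph on `ℤ/n` with generators `γ 0, …, γ (d - 1)`: for each vertex `v` and each
index `i` there is one edge, labelled `(v, i)`, that joins `v` and `v + γ i`. For `1 ≤ n` this is a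
`2d`-regular multigraph; repeated generators give parallel edges, as does `γ i = n / 2`. -/
def circulant {d : ℕ} (n : ℕ) (γ : Fin d → ℕ) : Graph (ZMod n) (ZMod n × Fin d) where
  vertexSet := Set.univ
  IsLink e x y := s(x, y) = s(e.1, e.1 + (γ e.2 : ZMod n))
  isLink_symm _ _ := ⟨fun _ _ h => Sym2.eq_swap.trans h⟩
  eq_or_eq_of_isLink_of_isLink _ _ _ _ _ h h' := by
    have h2 := h.trans h'.symm
    rw [Sym2.eq_iff] at h2
    rcases h2 with h2 | h2
    · exact Or.inl h2.1
    · exact Or.inr h2.1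
  left_mem_of_isLink _ _ _ _ := Set.mem_univ _

/-- `z` is the tree entropy of the sequence `G n`, i.e. the limit of `log τ(G n) / |V(G n)|` exists
and equals `z`. -/
def IsTreeEntropy {V E : ℕ → Type*} (G : ∀ n, Graph (V n) (E n)) (z : ℝ) : Prop :=
  Filter.Tendsto
    (fun n => Real.log (spanningTreeCount (G n) : ℝ) / ((Graph.vertexSet (G n)).ncard : ℝ))
    Filter.atTop (nhds z)

/-- The circulant graph on `ℤ/n` with fixed generators `1, γ 0, …, γ (d - 1)`. -/
def fixedCirculant {d : ℕ} (γ : Fin d → ℕ) (n : ℕ) : Graph (ZMod n) (ZMod n × Fin (d + 1)) :=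
  circulant n (Fin.cons 1 γ)

/-- The circulant graph on `ℤ/βn` with non-fixed generators `1, γ 0 * n, …, γ (d - 1) * n`. -/
def nonFixedCirculant {d : ℕ} (β : ℕ) (γ : Fin d → ℕ) (n : ℕ) :
    Graph (ZMod (β * n)) (ZMod (β * n) × Fin (d + 1)) :=
  circulant (β * n) (Fin.cons 1 (fun i => γ i * n))

/-!
The number of spanning trees of a circulant graph on `ℤ/n` is `1/n` times the product of the nonzero
Laplacian eigenvalues (`spanningTreeCount_circulant_mul`). Both entropies are therefore limits of
Riemann sums of logarithms, and the inequality compares two explicit integrals.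

**Matrix-tree theorem** (`Graph.IsHalfEdgeSystem.det_rootedLaplacian`). Replace the row of a root
`r` of the Laplacian by a row of the identity matrix. Every other row is a sum, over the half-edges
at its vertex, of differences of two basis vectors, so by multilinearity the determinant is a sum
over all choices of one half-edge at every vertex other than `r`. A choice defines a self-map of the
vertices. Its determinant is `1` if the map leads every vertex to `r` (the matrix is `1` minus a
nilpotent matrix), and `0` otherwise (the indicator of the vertices that never reach `r` is in the
kernel). The choices that lead to `r` are the spanning trees, oriented towards `r`.

**Existence of the limits.** For fixed generators, dividing the eigenvalues by those of the cycle,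
whose product is known, leaves a continuous function that is at least `1` (`reducedSymbol`), so the
entropy is the integral of its logarithm. For non-fixed generators the eigenvalues with index `c`
modulo `β` are `a + chordSq t`, where `a` depends only on `c / β` and `t` runs through equally
spaced points. By Jensen's formula the mean of `log (a + chordSq t)` is `logMean a = 2 arsinh (√a /
2)`, which is continuous in `a ≥ 0`. Hence the entropy is a Riemann sum with `β` terms, and it tends
to an integral as `β → ∞`.

**The strict inequality** (`integral_log_reducedSymbol_lt`). With `γ 0, …, γ d` given, the limit for
`β → ∞` belongs to the group `ℤ × ℤ` with generators `(0, 1)`, `(1, 0)`, `(γ 0, 0)`, …, `(γ (d - 1),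
0)`. The entropy for fixed generators belongs to the quotient `ℤ` of this group by `(a, b) ↦ a + γ d
* b`. Expanding `log (R - S)` in powers of the step sum `S` turns the two integrals into generating
functions of the numbers of closed walks (`hasSum_moments`, `integral_integral_stepSum_pow`,
`integral_stepSum_line_pow`). A closed walk in `ℤ × ℤ` is closed in the quotient, and the walk with
`γ d` steps `(1, 0)` and one step `(0, -1)` is closed in the quotient only. The expansion needs `R`
larger than the number of steps, so the comparison is made for `R` increased by `ε > 0`; the gap
from the single walk does not vanish as `ε → 0`.
-/

/-! ### Determinants of rooted Laplacians -/

open Finset in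
/-- The Laplacian of the functional digraph of `f`, rooted at `r`, has determinant `1` if the
iterates of `f` lead from every vertex to `r`, and determinant `0` otherwise. -/
theorem det_one_sub_of_iterate {V R : Type*} [Fintype V] [DecidableEq V] [CommRing R] [IsDomain R]
    (f : V → V) (r : V) [Decidable (∀ v, ∃ k, f^[k] v = r)] :
    (Matrix.of fun v w => (Pi.single v 1 - if v = r then 0 else Pi.single (f v) 1 : V → R) w).det =
      if ∀ v, ∃ k, f^[k] v = r then 1 else 0 := by
  set N : Matrix V V R :=
    Matrix.of fun v w => (if v = r then 0 else Pi.single (f v) 1 : V → R) w with hN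
  have hM : (Matrix.of fun v w =>
      (Pi.single v 1 - if v = r then 0 else Pi.single (f v) 1 : V → R) w) = 1 - N := by
    ext v w
    simp [hN, Matrix.one_apply, Pi.single_apply, eq_comm]
  have hmul (x : V → R) (v : V) : (N.mulVec x) v = if v = r then 0 else x (f v) := by
    by_cases h : v = r
    · simp [hN, Matrix.mulVec, dotProduct, h]
    · simp [hN, Matrix.mulVec, dotProduct, h, Pi.single_apply]
  rw [hM]
  split_ifs with h
  · -- a row of `N ^ k` vanishes once the iterates of its index have reached the root
    have hpow : ∀ j v, f^[j] v = r → ∀ k, j < k → ∀ w, (N ^ k) v w = 0 := by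
      intro j
      induction j with
      | zero =>
        intro v hv k hk w
        obtain ⟨k, rfl⟩ := Nat.exists_eq_add_of_lt hk
        have := hmul (fun u => (N ^ (0 + k)) u w) v
        rw [if_pos (by simpa using hv)] at this
        rw [pow_succ']
        exact this
      | succ j ih =>
        intro v hv k hk w
        obtain ⟨k, rfl⟩ := Nat.exists_eq_succ_of_ne_zero (by omega : k ≠ 0)
        have := hmul (fun u => (N ^ k) u w) v
        rw [ih (f v) (by simpa using hv) k (by omega) w, ite_self] at this
        rw [pow_succ']
        exact this
    have hnil : IsNilpotent N := by
      choose k hk using h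
      refine ⟨∑ v, k v + 1, ?_⟩
      ext v w
      exact hpow _ v (hk v) _
        (Nat.lt_succ_of_le (single_le_sum (f := k) (fun _ _ => Nat.zero_le _) (mem_univ v))) w
    have hchar := (Matrix.isNilpotent_charpoly_sub_pow_of_isNilpotent hnil).eq_zero
    rw [sub_eq_zero] at hchar
    have := congrArg (Polynomial.eval 1) hchar
    rw [Matrix.eval_charpoly] at this
    simpa using this
  · push Not at h
    obtain ⟨v₀, hv₀⟩ := h
    classical
    rw [← Matrix.exists_mulVec_eq_zero_iff]
    -- the indicator function of the set of vertices that never reach the root is in the kernel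
    refine ⟨fun v => if ∀ k, f^[k] v ≠ r then 1 else 0, fun h0 => ?_, ?_⟩
    · simpa [hv₀] using congrFun h0 v₀
    · ext v
      rw [Matrix.sub_mulVec, Matrix.one_mulVec, Pi.sub_apply, hmul]
      by_cases hv : v = r
      · simp [hv]
        exact ⟨0, rfl⟩
      · have : (∀ k, f^[k] v ≠ r) ↔ ∀ k, f^[k] (f v) ≠ r :=
          ⟨fun h k => h (k + 1), fun h k => by cases k with
            | zero => exact hv
            | succ k => exact h k⟩
        simp only [if_neg hv, this]
        simp

/-- The Laplacian matrix of the graph in which `nxt v k` is the other end of the `k`-th half-edge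
at `v`, with the row of the root `r` replaced by a row of the identity matrix. -/
def rootedLaplacian {V K : Type*} (R : Type*) [DecidableEq V] [Fintype K] [Ring R]
    (nxt : V → K → V) (r : V) : Matrix V V R :=
  Matrix.of fun v =>
    if v = r then Pi.single v 1 else ∑ k, (Pi.single v 1 - Pi.single (nxt v k) 1)

/-- The choices of one half-edge at every vertex except the root `r`, as functions with the value `none`
at `r` only. -/
def rootedChoices {V : Type*} (K : Type*) [Fintype V] [DecidableEq V] [Fintype K] (r : V) :
    Finset (V → Option K) :=
  Fintype.piFinset fun v => if v = r then {none} else Finset.univ.map Function.Embedding.some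

theorem mem_rootedChoices {V K : Type*} [Fintype V] [DecidableEq V] [Fintype K] {r : V}
    {c : V → Option K} : c ∈ rootedChoices K r ↔ ∀ v, c v = none ↔ v = r := by
  rw [rootedChoices, Fintype.mem_piFinset]
  refine forall_congr' fun v => ?_
  by_cases h : v = r
  · simp [h]
  · simp [h, Option.ne_none_iff_exists]

/-- The other end of the half-edge chosen at `v`, or `v` itself if none is chosen. -/
def choiceStep {V K : Type*} (nxt : V → K → V) (c : V → Option K) (v : V) : V :=
  (c v).elim v (nxt v)

/-- Following the chosen half-edges leads from every vertex to `r`. -/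
def LeadsTo {V K : Type*} (nxt : V → K → V) (r : V) (c : V → Option K) : Prop :=
  ∀ v, ∃ k, (choiceStep nxt c)^[k] v = r

open Classical in
theorem det_rootedLaplacian {V K R : Type*} [Fintype V] [DecidableEq V] [Fintype K] [CommRing R]
    [IsDomain R] (nxt : V → K → V) (r : V) :
    (rootedLaplacian R nxt r).det =
      (((rootedChoices K r).filter (LeadsTo nxt r)).card : R) := by
  let g : V → Option K → V → R := fun v o =>
    Pi.single v 1 - o.elim 0 fun k => Pi.single (nxt v k) 1
  have hrow : rootedLaplacian R nxt r = Matrix.of fun v =>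
      ∑ o ∈ if v = r then {none} else Finset.univ.map Function.Embedding.some, g v o := by
    ext v w
    simp only [rootedLaplacian, Matrix.of_apply]
    split_ifs with h <;> simp [g]
  have := (Matrix.detRowAlternating (n := V) (R := R)).toMultilinearMap.map_sum_finset
    (fun v o => g v o) (fun v => if v = r then {none} else Finset.univ.map Function.Embedding.some)
  rw [hrow, Finset.card_filter, Nat.cast_sum]
  refine this.trans (Finset.sum_congr rfl fun c hc => ?_)
  rw [Nat.cast_ite, Nat.cast_one, Nat.cast_zero]
  have hc' := mem_rootedChoices.1 hc
  have key := det_one_sub_of_iterate (R := R) (choiceStep nxt c) r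
  refine Eq.trans ?_ (key.trans (if_congr Iff.rfl rfl rfl))
  change Matrix.det _ = _
  congr 1
  ext v w
  simp only [g, Matrix.of_apply]
  by_cases h : v = r
  · simp [h, (hc' r).2 rfl]
  · obtain ⟨k, hk⟩ := Option.ne_none_iff_exists.1 (fun h' => h ((hc' v).1 h'))
    simp [h, choiceStep, ← hk]

/-! ### Trees oriented towards a root -/

theorem iterate_ne_of_mapsTo {V : Type*} {f : V → V} {r : V} {S : Set V} (hS : Set.MapsTo f S S)
    (hr : r ∉ S) {v : V} (hv : v ∈ S) : ¬ ∃ k, f^[k] v = r := by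
  rintro ⟨k, rfl⟩
  exact hr (hS.iterate k hv)

/-- If `f` leads from every vertex to `r`, then it has no cycle of length at most two
outside `r`, so the edges `{v, f v}` with `v ≠ r` are distinct. -/
theorem injOn_sym2_of_iterate {V : Type*} {f : V → V} {r : V} (hf : ∀ v, ∃ k, f^[k] v = r) :
    Set.InjOn (fun v => s(v, f v)) {v | v ≠ r} := by
  intro v hv w hw h
  rcases Sym2.eq_iff.1 h with ⟨h, -⟩ | ⟨h1, h2⟩
  · exact h
  · refine absurd (hf v) (iterate_ne_of_mapsTo (S := {v, w}) ?_ ?_ (by simp))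
    · rintro x (rfl | rfl)
      · exact Or.inr h2
      · exact Or.inl h1.symm
    · rintro (rfl | rfl)
      · exact hv rfl
      · exact hw rfl

theorem ne_of_iterate {V : Type*} {f : V → V} {r v : V} (hf : ∀ v, ∃ k, f^[k] v = r)
    (hv : v ≠ r) : f v ≠ v := by
  intro h
  refine absurd (hf v) (iterate_ne_of_mapsTo (S := {v}) ?_ ?_ rfl)
  · rintro x rfl
    exact h
  · exact fun h => hv h.symm

theorem ncard_image_sym2_of_iterate {V : Type*} [Fintype V] {f : V → V} {r : V}
    (hf : ∀ v, ∃ k, f^[k] v = r) :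
    ((fun v => s(v, f v)) '' {v | v ≠ r}).ncard + 1 = Nat.card V := by
  rw [(injOn_sym2_of_iterate hf).ncard_image]
  have : {v : V | v ≠ r} = {r}ᶜ := rfl
  rw [this, ← Set.ncard_singleton r, add_comm, Set.ncard_add_ncard_compl]

theorem SimpleGraph.isTree_of_iterate {V : Type*} [Fintype V] {H : SimpleGraph V} {f : V → V}
    {r : V} (hf : ∀ v, ∃ k, f^[k] v = r)
    (hH : ∀ u v, H.Adj u v ↔ ∃ w, w ≠ r ∧ s(w, f w) = s(u, v)) : H.IsTree := by
  rw [isTree_iff_connected_and_card]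
  constructor
  · have hr : ∀ k v, f^[k] v = r → H.Reachable v r := by
      intro k
      induction k with
      | zero => rintro v rfl; rfl
      | succ k ih =>
        intro v hv
        by_cases h : v = r
        · rw [h]
        · have hadj : H.Adj v (f v) := (hH _ _).2 ⟨v, h, rfl⟩
          exact hadj.reachable.trans (ih _ hv)
    have : Nonempty V := ⟨r⟩
    refine ⟨fun u v => ?_⟩
    obtain ⟨k, hk⟩ := hf u
    obtain ⟨l, hl⟩ := hf v
    exact (hr k u hk).trans (hr l v hl).symm
  · have : H.edgeSet = (fun v => s(v, f v)) '' {v | v ≠ r} := by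
      ext e
      induction e with | h u v => exact hH u v
    rw [Nat.card_coe_set_eq, this, ncard_image_sym2_of_iterate hf]

/-- In a tree, the map that sends each vertex to the next vertex on the way to the root `r`. -/
theorem SimpleGraph.IsTree.exists_iterate {V : Type*} [Fintype V] {H : SimpleGraph V}
    (hH : H.IsTree) (r : V) : ∃ f : V → V, (∀ v, v ≠ r → H.Adj v (f v)) ∧
      (∀ v, ∃ k, f^[k] v = r) ∧ ∀ u v, H.Adj u v → ∃ w, w ≠ r ∧ s(w, f w) = s(u, v) := by
  have hnext : ∀ v, v ≠ r → ∃ w, H.Adj v w ∧ H.dist w r < H.dist v r := by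
    intro v hv
    obtain ⟨p, hp⟩ := hH.connected.exists_walk_length_eq_dist v r
    cases p with
    | nil => exact absurd rfl hv
    | @cons _ w _ h q =>
      refine ⟨w, h, ?_⟩
      rw [← hp, SimpleGraph.Walk.length_cons]
      exact Nat.lt_succ_of_le (SimpleGraph.dist_le q)
  choose! f hadj hlt using hnext
  have hf : ∀ n v, H.dist v r ≤ n → ∃ k, f^[k] v = r := by
    intro n
    induction n with
    | zero => exact fun v hv => ⟨0, hH.connected.dist_eq_zero_iff.1 (Nat.le_zero.1 hv)⟩
    | succ n ih =>
      intro v hv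
      by_cases h : v = r
      · exact ⟨0, h⟩
      · obtain ⟨k, hk⟩ := ih (f v) (by have := hlt v h; omega)
        exact ⟨k + 1, hk⟩
  have hf' : ∀ v, ∃ k, f^[k] v = r := fun v => hf _ v le_rfl
  refine ⟨f, hadj, hf', fun u v huv => ?_⟩
  have hsub : (fun v => s(v, f v)) '' {v | v ≠ r} ⊆ H.edgeSet := by
    rintro _ ⟨v, hv, rfl⟩
    exact hadj v hv
  have hcard := (isTree_iff_connected_and_card.1 hH).2
  rw [Nat.card_coe_set_eq, ← ncard_image_sym2_of_iterate hf', Nat.add_right_cancel_iff] at hcard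
  have heq := Set.eq_of_subset_of_ncard_le hsub hcard.le (Set.toFinite _)
  have : s(u, v) ∈ H.edgeSet := huv
  rw [← heq] at this
  exact this

/-! ### The matrix-tree theorem -/

open Graph

/-- The `k`-th half-edge at `v` belongs to the edge `edge v k` of `G` and points to `nxt v k`. Every
vertex has its half-edges indexed by `K`, and an edge that is not a loop gives one half-edge at each
of its two ends. Loops may be counted more than once. -/
structure Graph.IsHalfEdgeSystem {V E K : Type*} (G : Graph V E) (nxt : V → K → V)
    (edge : V → K → E) : Prop where
  vertexSet_eq : G.vertexSet = Set.univ
  isLink (v : V) (k : K) : G.IsLink (edge v k) v (nxt v k)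
  exists_of_isLink {e : E} {x y : V} : G.IsLink e x y → ∃ k, edge x k = e ∧ nxt x k = y
  eq_of_edge_eq {v : V} {k l : K} : nxt v k ≠ v → edge v k = edge v l → k = l

/-- The set of edges chosen by `c`. -/
def chosenEdges {V E K : Type*} (edge : V → K → E) (c : V → Option K) : Set E :=
  {e | ∃ v k, c v = some k ∧ edge v k = e}

theorem isTree_toSimpleGraph_iff {V E : Type*} {T : Graph V E} (hT : T.vertexSet = Set.univ)
    {H : SimpleGraph V} (hH : ∀ u v, H.Adj u v ↔ u ≠ v ∧ T.Adj u v) :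
    T.toSimpleGraph.IsTree ↔ H.IsTree := by
  refine SimpleGraph.Iso.isTree_iff ⟨Equiv.subtypeUnivEquiv (fun x => hT ▸ Set.mem_univ x), ?_⟩
  intro a b
  simp [hH, Graph.toSimpleGraph, Subtype.ext_iff]

theorem choiceStep_of_eq_some {V K : Type*} {nxt : V → K → V} {c : V → Option K} {v : V} {k : K}
    (h : c v = some k) :
    choiceStep nxt c v = nxt v k := by
  simp [choiceStep, h]

section
variable {V E K : Type*} [Fintype V] [DecidableEq V] [Fintype K] {G : Graph V E} {nxt : V → K → V}
  {edge : V → K → E} {r : V}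

theorem exists_eq_some_of_mem_rootedChoices {c : V → Option K} (hc : c ∈ rootedChoices K r) {v : V}
    (hv : v ≠ r) : ∃ k, c v = some k :=
  Option.ne_none_iff_exists'.1 fun h => hv ((mem_rootedChoices.1 hc v).1 h)

theorem ne_root_of_eq_some {c : V → Option K} (hc : c ∈ rootedChoices K r) {v : V} {k : K}
    (hk : c v = some k) : v ≠ r := by
  rintro rfl
  rw [(mem_rootedChoices.1 hc v).2 rfl] at hk
  cases hk

theorem Graph.IsHalfEdgeSystem.exists_isLink_iff (hG : G.IsHalfEdgeSystem nxt edge)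
    {c : V → Option K} (hc : c ∈ rootedChoices K r) (u v : V) :
    (G.restrict (chosenEdges edge c)).Adj u v ↔
      ∃ w, w ≠ r ∧ s(w, choiceStep nxt c w) = s(u, v) := by
  constructor
  · rintro ⟨e, ⟨w, k, hk, rfl⟩, he⟩
    refine ⟨w, ne_root_of_eq_some hc hk, ?_⟩
    rw [choiceStep_of_eq_some hk]
    exact (((hG.isLink w k).isLink_iff_sym2_eq).1 he)
  · rintro ⟨w, hw, h⟩
    obtain ⟨k, hk⟩ := exists_eq_some_of_mem_rootedChoices hc hw
    rw [choiceStep_of_eq_some hk] at h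
    exact ⟨edge w k, ⟨w, k, hk, rfl⟩, ((hG.isLink w k).isLink_iff_sym2_eq).2 h⟩

theorem Graph.IsHalfEdgeSystem.restrict_simple (hG : G.IsHalfEdgeSystem nxt edge)
    {c : V → Option K} (hc : c ∈ rootedChoices K r) (hlead : LeadsTo nxt r c) :
    (G.restrict (chosenEdges edge c)).Simple := by
  refine { not_isLoopAt := ?_, eq_of_isLink := ?_ }
  · rintro e x ⟨⟨w, k, hk, rfl⟩, he⟩
    have h := ((hG.isLink w k).isLink_iff_sym2_eq).1 he
    have hne := ne_of_iterate hlead (ne_root_of_eq_some hc hk)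
    rw [choiceStep_of_eq_some hk] at hne
    rcases Sym2.eq_iff.1 h with h | h
    · exact hne (h.2.trans h.1.symm)
    · exact hne (h.2.trans h.1.symm)
  · rintro e f x y ⟨⟨w, k, hk, rfl⟩, he⟩ ⟨⟨w', k', hk', rfl⟩, hf⟩
    have h := ((hG.isLink w k).isLink_iff_sym2_eq).1 he
    have h' := ((hG.isLink w' k').isLink_iff_sym2_eq).1 hf
    have : w = w' := by
      apply injOn_sym2_of_iterate hlead (ne_root_of_eq_some hc hk) (ne_root_of_eq_some hc hk')
      simp only [choiceStep_of_eq_some hk, choiceStep_of_eq_some hk', h, h']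
    subst this
    rw [hk, Option.some_inj] at hk'
    rw [hk']

theorem Graph.IsHalfEdgeSystem.restrict_isTree (hG : G.IsHalfEdgeSystem nxt edge)
    {c : V → Option K} (hc : c ∈ rootedChoices K r) (hlead : LeadsTo nxt r c) :
    (G.restrict (chosenEdges edge c)).toSimpleGraph.IsTree := by
  have hs := hG.restrict_simple hc hlead
  let H : SimpleGraph V :=
    { Adj := fun u v => (G.restrict (chosenEdges edge c)).Adj u v
      symm := ⟨fun _ _ h => h.symm⟩
      loopless := ⟨fun v h => h.ne rfl⟩ }
  rw [isTree_toSimpleGraph_iff (T := G.restrict (chosenEdges edge c)) (H := H) hG.vertexSet_eq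
    fun u v => ⟨fun h => ⟨h.ne, h⟩, fun h => h.2⟩]
  exact SimpleGraph.isTree_of_iterate hlead (hG.exists_isLink_iff hc)

/-- A choice of half-edges that leads to the root is determined by the set of its edges: a vertex at
which two such choices differ is sent by either choice to another such vertex. -/
theorem Graph.IsHalfEdgeSystem.chosenEdges_injOn (hG : G.IsHalfEdgeSystem nxt edge) :
    Set.InjOn (chosenEdges edge) {c | c ∈ rootedChoices K r ∧ LeadsTo nxt r c} := by
  rintro c ⟨hc, hlc⟩ d ⟨hd, hld⟩ h
  by_contra hne
  obtain ⟨v, hv⟩ := Function.ne_iff.1 hne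
  refine absurd (hld v) (iterate_ne_of_mapsTo (S := {v | c v ≠ d v}) ?_ ?_ hv)
  · intro v hv hcon
    have hvr : v ≠ r := by
      rintro rfl
      exact hv (((mem_rootedChoices.1 hc v).2 rfl).trans ((mem_rootedChoices.1 hd v).2 rfl).symm)
    obtain ⟨k, hk⟩ := exists_eq_some_of_mem_rootedChoices hd hvr
    have hloop := ne_of_iterate hld hvr
    rw [choiceStep_of_eq_some hk] at hloop hcon
    have hmem : edge v k ∈ chosenEdges edge c := h ▸ ⟨v, k, hk, rfl⟩
    obtain ⟨w, l, hl, hwl⟩ := hmem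
    have hlink := hG.isLink w l
    rw [hwl, (hG.isLink v k).isLink_iff_sym2_eq] at hlink
    rcases Sym2.eq_iff.1 hlink with ⟨rfl, -⟩ | ⟨h1, h2⟩
    · rw [hG.eq_of_edge_eq hloop hwl.symm] at hk
      exact hv (hl.trans hk.symm)
    · -- the edge `{v, w}` is chosen by `c` at `w` and by `d` at `v`, so `d` differs from `c` at `w`
      rw [h2, hl] at hcon
      have hvw : v ≠ w := by rintro rfl; exact hloop h2
      refine hvw (injOn_sym2_of_iterate hld hvr (ne_root_of_eq_some hd hcon.symm) ?_)
      simp only [choiceStep_of_eq_some hk, choiceStep_of_eq_some hcon.symm, h2, ← h1]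
      exact Sym2.eq_swap
  · exact fun hr =>
      hr (((mem_rootedChoices.1 hc r).2 rfl).trans ((mem_rootedChoices.1 hd r).2 rfl).symm)

theorem Graph.IsHalfEdgeSystem.exists_restrict_eq (hG : G.IsHalfEdgeSystem nxt edge) (r : V)
    {T : Graph V E} (hT : T ≤s G) (hs : T.Simple) (ht : T.toSimpleGraph.IsTree) :
    ∃ c ∈ rootedChoices K r, LeadsTo nxt r c ∧ G.restrict (chosenEdges edge c) = T := by
  have hV : T.vertexSet = Set.univ := hT.vertexSet_eq.trans hG.vertexSet_eq
  let H : SimpleGraph V :=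
    { Adj := fun u v => T.Adj u v
      symm := ⟨fun _ _ h => h.symm⟩
      loopless := ⟨fun v h => h.ne rfl⟩ }
  rw [isTree_toSimpleGraph_iff (H := H) hV fun u v => ⟨fun h => ⟨h.ne, h⟩, fun h => h.2⟩] at ht
  obtain ⟨f, hadj, hf, hcov⟩ := ht.exists_iterate r
  have hk : ∀ v, v ≠ r → ∃ k, T.IsLink (edge v k) v (f v) ∧ nxt v k = f v := by
    intro v hv
    obtain ⟨e, he⟩ := hadj v hv
    obtain ⟨k, rfl, hk⟩ := hG.exists_of_isLink (he.mono hT.le)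
    exact ⟨k, he, hk⟩
  choose k hk hkn using hk
  let c : V → Option K := fun v => if h : v = r then none else some (k v h)
  have hcv : ∀ v (h : v ≠ r), c v = some (k v h) := fun v h => dif_neg h
  have hstep : ∀ v, v ≠ r → choiceStep nxt c v = f v := fun v hv => by
    rw [choiceStep_of_eq_some (hcv v hv), hkn]
  have hc : c ∈ rootedChoices K r := by
    rw [mem_rootedChoices]
    intro v
    by_cases h : v = r <;> simp [c, h]
  have hlead : LeadsTo nxt r c := by
    have : ∀ j v, f^[j] v = r → ∃ i, (choiceStep nxt c)^[i] v = r := by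
      intro j
      induction j with
      | zero => exact fun v hv => ⟨0, hv⟩
      | succ j ih =>
        intro v hv
        by_cases h : v = r
        · exact ⟨0, h⟩
        · obtain ⟨i, hi⟩ := ih (f v) hv
          exact ⟨i + 1, by rw [Function.iterate_succ_apply, hstep v h, hi]⟩
    intro v
    obtain ⟨j, hj⟩ := hf v
    exact this j v hj
  refine ⟨c, hc, hlead, Graph.Compatible.ext ?_ ?_
    (Graph.Compatible.of_le_le (G := G) (by simp) hT.le)⟩
  · exact hT.vertexSet_eq.symm
  · ext e
    constructor
    · rintro ⟨-, v, l, hl, rfl⟩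
      have hv := ne_root_of_eq_some hc hl
      rw [hcv v hv, Option.some_inj] at hl
      exact hl ▸ (hk v hv).edge_mem
    · intro he
      obtain ⟨x, y, hxy⟩ := T.exists_isLink_of_mem_edgeSet he
      obtain ⟨w, hw, hwe⟩ := hcov x y ⟨e, hxy⟩
      have := ((hk w hw).isLink_iff_sym2_eq).2 hwe
      exact ⟨(hxy.mono hT.le).edge_mem, w, _, hcv w hw, this.eq hxy⟩

/-- The **matrix-tree theorem** for multigraphs with loops. -/
theorem Graph.IsHalfEdgeSystem.det_rootedLaplacian {R : Type*} [CommRing R] [IsDomain R]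
    (hG : G.IsHalfEdgeSystem nxt edge) (r : V) :
    (rootedLaplacian R nxt r).det = (spanningTreeCount G : R) := by
  classical
  rw [_root_.det_rootedLaplacian]
  congr 1
  rw [← Set.ncard_coe_finset, spanningTreeCount]
  have himage : {T : Graph V E | T ≤s G ∧ T.Simple ∧ T.toSimpleGraph.IsTree} =
      (fun c => G.restrict (chosenEdges edge c)) ''
        ((rootedChoices K r).filter (LeadsTo nxt r) : Finset (V → Option K)) := by
    ext T
    constructor
    · rintro ⟨h1, h2, h3⟩
      obtain ⟨c, hc, hl, h⟩ := hG.exists_restrict_eq r h1 h2 h3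
      exact ⟨c, by simp [hc, hl], h⟩
    · rintro ⟨c, hc, rfl⟩
      obtain ⟨hc, hl⟩ := Finset.mem_filter.1 (Finset.mem_coe.1 hc)
      exact ⟨⟨by simp, rfl⟩, hG.restrict_simple hc hl, hG.restrict_isTree hc hl⟩
  rw [himage, Set.InjOn.ncard_image]
  intro c hc d hd h
  refine hG.chosenEdges_injOn (r := r) (by simpa using hc) (by simpa using hd) ?_
  have hE : ∀ c : V → Option K, chosenEdges edge c ⊆ G.edgeSet := by
    rintro c _ ⟨v, k, -, rfl⟩
    exact (hG.isLink v k).edge_mem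
  have := congrArg Graph.edgeSet h
  simpa [Set.inter_eq_right.2 (hE _)] using this

end

/-- For a square matrix whose rows and columns sum to zero, the determinant after adding the
all-ones matrix is the number of rows squared times any principal cofactor. -/
theorem Matrix.det_add_ones_of_sum_eq_zero {V R : Type*} [Fintype V] [DecidableEq V] [CommRing R]
    [IsDomain R] (M : Matrix V V R) (hrow : ∀ v, ∑ w, M v w = 0) (hcol : ∀ w, ∑ v, M v w = 0)
    (r : V) :
    (M + Matrix.of fun _ _ => 1).det =
      (Fintype.card V : R) ^ 2 * (M.updateRow r (Pi.single r 1)).det := by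
  set n : R := (Fintype.card V : R)
  have h1 : (M + Matrix.of fun _ _ => 1).det =
      ((M + Matrix.of fun _ _ => 1).updateRow r (n • 1)).det := by
    have := Matrix.det_updateRow_sum (M + Matrix.of fun _ _ => 1) r 1
    simp only [Pi.one_apply, one_smul] at this
    rw [← this]
    congr 2
    ext w
    refine (Finset.sum_apply w Finset.univ _).trans ?_
    change ∑ v, (M v w + 1) = n * 1
    simp [Finset.sum_add_distrib, hcol, n]
  have h2 : ((M + Matrix.of fun _ _ => 1).updateRow r 1).det = (M.updateRow r 1).det := by
    refine Matrix.det_eq_of_forall_row_eq_smul_add_const (fun v => if v = r then 0 else 1) r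
      (by simp) fun v w => ?_
    by_cases h : v = r
    · simp [h]
    · simp [h]
  have h3 : (M.updateRow r 1).det = n * (M.updateRow r (Pi.single r 1)).det := by
    have hsum : (1 : V → R) = (1 - n • Pi.single r 1) + n • Pi.single r 1 := by simp
    have hker : (M.updateRow r (1 - n • Pi.single r 1)).det = 0 := by
      -- the constant functions are in the kernel
      rw [← Matrix.exists_mulVec_eq_zero_iff]
      refine ⟨1, fun h => one_ne_zero (congrFun h r), ?_⟩
      ext v
      by_cases h : v = r
      · subst h
        simp [Matrix.mulVec, dotProduct, n, ← Finset.mul_sum]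
      · simp [Matrix.mulVec, dotProduct, h, hrow]
    rw [hsum, Matrix.det_updateRow_add, hker, zero_add, Matrix.det_updateRow_smul]
  rw [h1, Matrix.det_updateRow_smul, h2, h3]
  ring

/-! ### Laplacian eigenvalues of circulant graphs -/

/-- The other ends of the half-edges of a circulant graph at a vertex: the half-edge `(i, true)` at
`v` points to `v + γ i`, and `(i, false)` points to `v - γ i`. -/
def circulantNext {d : ℕ} (n : ℕ) (γ : Fin d → ℕ) (v : ZMod n) (k : Fin d × Bool) : ZMod n :=
  if k.2 then v + γ k.1 else v - γ k.1

/-- The edges that contain the half-edges of a circulant graph at a vertex, labelled as in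
`circulant`. -/
def circulantEdge {d : ℕ} (n : ℕ) (γ : Fin d → ℕ) (v : ZMod n) (k : Fin d × Bool) :
    ZMod n × Fin d :=
  if k.2 then (v, k.1) else (v - γ k.1, k.1)

theorem circulant_isHalfEdgeSystem {d : ℕ} (n : ℕ) (γ : Fin d → ℕ) :
    (circulant n γ).IsHalfEdgeSystem (circulantNext n γ) (circulantEdge n γ) where
  vertexSet_eq := rfl
  isLink := by
    rintro v ⟨i, b⟩
    cases b
    · simp [circulant, circulantNext, circulantEdge]
    · simp [circulant, circulantNext, circulantEdge]
  exists_of_isLink := by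
    rintro ⟨u, i⟩ x y h
    rcases Sym2.eq_iff.1 h with ⟨rfl, rfl⟩ | ⟨rfl, rfl⟩
    · exact ⟨(i, true), by simp [circulantEdge], by simp [circulantNext]⟩
    · exact ⟨(i, false), by simp [circulantEdge], by simp [circulantNext]⟩
  eq_of_edge_eq := by
    rintro v ⟨i, b⟩ ⟨j, b'⟩ hne h
    cases b <;> cases b' <;> simp [circulantNext, circulantEdge] at h hne ⊢
    · exact h.2
    · exact hne h.1
    · obtain ⟨h, rfl⟩ := h
      exact hne (sub_eq_self.1 h.symm)
    · exact h

/-- The Laplacian matrix of a circulant graph. -/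
def circulantLaplacian {d : ℕ} (n : ℕ) (γ : Fin d → ℕ) : Matrix (ZMod n) (ZMod n) ℂ :=
  Matrix.of fun v => ∑ k, (Pi.single v 1 - Pi.single (circulantNext n γ v k) 1)

theorem det_circulantLaplacian_add_ones {d : ℕ} (n : ℕ) [NeZero n] (γ : Fin d → ℕ) :
    (circulantLaplacian n γ + Matrix.of fun _ _ => 1).det =
      (n : ℂ) ^ 2 * spanningTreeCount (circulant n γ) := by
  rw [Matrix.det_add_ones_of_sum_eq_zero _ _ _ 0,
    ← (circulant_isHalfEdgeSystem n γ).det_rootedLaplacian 0, ZMod.card]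
  · congr 2
    ext v w
    by_cases h : v = 0
    · subst h
      simp [rootedLaplacian]
    · simp [rootedLaplacian, h, circulantLaplacian]
  · intro v
    simp only [circulantLaplacian, Matrix.of_apply, Finset.sum_apply, Pi.sub_apply]
    rw [Finset.sum_comm]
    simp
  · intro w
    simp only [circulantLaplacian, Matrix.of_apply, Finset.sum_apply, Pi.sub_apply]
    rw [Finset.sum_comm]
    refine Finset.sum_eq_zero fun k _ => ?_
    have hbij : Function.Bijective fun v => circulantNext n γ v k := by
      rcases k with ⟨i, b⟩
      cases b
      · simpa [circulantNext] using (Equiv.subRight (γ i : ZMod n)).bijective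
      · simpa [circulantNext] using (Equiv.addRight (γ i : ZMod n)).bijective
    rw [Finset.sum_sub_distrib, hbij.sum_comp (fun v => (Pi.single v 1 : ZMod n → ℂ) w), sub_self]

open ZMod in
/-- The characters of `ℤ/n` diagonalize the Laplacian and the all-ones matrix simultaneously. -/
theorem det_circulantLaplacian_add_ones_eq_prod {d : ℕ} (n : ℕ) [NeZero n] (γ : Fin d → ℕ) :
    (circulantLaplacian n γ + Matrix.of fun _ _ => 1).det =
      ∏ k : ZMod n, ((if k = 0 then (n : ℂ) else 0) +
        ∑ i, (2 - stdAddChar ((γ i : ZMod n) * k) - stdAddChar (-((γ i : ZMod n) * k)))) := by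
  let F : Matrix (ZMod n) (ZMod n) ℂ := Matrix.of fun v k => stdAddChar (v * k)
  let F' : Matrix (ZMod n) (ZMod n) ℂ := Matrix.of fun k v => stdAddChar (-(k * v))
  have hsum (b : ZMod n) : ∑ v, stdAddChar (v * b) = if b = 0 then (n : ℂ) else 0 := by
    have := AddChar.sum_mulShift b (isPrimitive_stdAddChar n)
    rw [ZMod.card] at this
    exact_mod_cast this
  have hF : F.det ≠ 0 := by
    have hmul : F' * F = (n : ℂ) • 1 := by
      ext k l
      simp only [F, F', Matrix.mul_apply, Matrix.of_apply, ← AddChar.map_add_eq_mul]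
      have : ∀ v, -(k * v) + v * l = v * (l - k) := fun v => by ring
      simp only [this, hsum, sub_eq_zero, Matrix.smul_apply, Matrix.one_apply, eq_comm]
      simp
    intro h
    have := congrArg Matrix.det hmul
    rw [Matrix.det_mul, h, mul_zero, Matrix.det_smul, Matrix.det_one, mul_one] at this
    exact pow_ne_zero _ (Nat.cast_ne_zero.2 (NeZero.ne n)) this.symm
  have hkey : (circulantLaplacian n γ + Matrix.of fun _ _ => 1) * F = F * Matrix.diagonal fun k =>
      (if k = 0 then (n : ℂ) else 0) +
        ∑ i, (2 - stdAddChar ((γ i : ZMod n) * k) - stdAddChar (-((γ i : ZMod n) * k))) := by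
    ext v k
    rw [Matrix.add_mul, Matrix.add_apply, Matrix.mul_diagonal, mul_add, add_comm]
    congr 1
    · simp only [F, Matrix.mul_apply, Matrix.of_apply, one_mul, hsum]
      split_ifs with h
      · simp [h]
      · simp
    · simp only [F, circulantLaplacian, Matrix.mul_apply, Matrix.of_apply, Finset.sum_apply,
        Pi.sub_apply, Finset.sum_mul, sub_mul]
      rw [Finset.sum_comm, Fintype.sum_prod_type, Finset.mul_sum]
      refine Finset.sum_congr rfl fun i _ => ?_
      simp only [Fintype.sum_bool, Finset.sum_sub_distrib, Pi.single_apply, ite_mul, one_mul,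
        zero_mul, Finset.sum_ite_eq', Finset.mem_univ, if_true, circulantNext]
      simp only [Bool.false_eq_true, if_false, add_mul, sub_eq_add_neg, neg_mul,
        AddChar.map_add_eq_mul]
      ring
  have := congrArg Matrix.det hkey
  rw [Matrix.det_mul, Matrix.det_mul, mul_comm, Matrix.det_diagonal] at this
  exact mul_left_cancel₀ hF this

/-- The eigenvalue of the Laplacian of a circulant graph with generators `γ` at the character
`v ↦ exp (2 π i v x)`. -/
noncomputable def circulantSymbol {d : ℕ} (γ : Fin d → ℕ) (x : ℝ) : ℝ :=
  ∑ i, (2 - 2 * Real.cos (2 * Real.pi * (γ i * x)))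

open ZMod in
theorem stdAddChar_add_stdAddChar_neg (n : ℕ) [NeZero n] (g j : ℕ) :
    stdAddChar ((g : ZMod n) * (j : ZMod n)) + stdAddChar (-((g : ZMod n) * (j : ZMod n))) =
      ((2 * Real.cos (2 * Real.pi * (g * (j / n))) : ℝ) : ℂ) := by
  have h1 : ((g : ZMod n) * (j : ZMod n)) = ((g * j : ℤ) : ZMod n) := by push_cast; rfl
  have h2 : -((g : ZMod n) * (j : ZMod n)) = ((-(g * j) : ℤ) : ZMod n) := by push_cast; rfl
  rw [h2, h1, stdAddChar_coe, stdAddChar_coe]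
  push_cast
  rw [Complex.cos]
  field_simp

/-- The number of spanning trees of a circulant graph, times the number of vertices, is the product
of the nonzero eigenvalues of the Laplacian. -/
theorem spanningTreeCount_circulant_mul {d : ℕ} (m : ℕ) (γ : Fin d → ℕ) :
    (spanningTreeCount (circulant (m + 1) γ) : ℝ) * (m + 1 : ℕ) =
      ∏ j ∈ Finset.range m, circulantSymbol γ ((j + 1 : ℕ) / (m + 1 : ℕ)) := by
  have h := (det_circulantLaplacian_add_ones (m + 1) γ).symm.trans
    (det_circulantLaplacian_add_ones_eq_prod (m + 1) γ)
  have hval : ∀ k : ZMod (m + 1), (∑ i, (2 - ZMod.stdAddChar ((γ i : ZMod (m + 1)) * k)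
      - ZMod.stdAddChar (-((γ i : ZMod (m + 1)) * k)))) =
      ((circulantSymbol γ (k.val / (m + 1 : ℕ)) : ℝ) : ℂ) := by
    intro k
    rw [circulantSymbol, Complex.ofReal_sum]
    refine Finset.sum_congr rfl fun i _ => ?_
    have := stdAddChar_add_stdAddChar_neg (m + 1) (γ i) k.val
    rw [ZMod.natCast_zmod_val] at this
    rw [sub_sub, this]
    push_cast
    ring
  simp only [hval] at h
  have h' : (((m + 1 : ℕ) : ℝ) ^ 2 * spanningTreeCount (circulant (m + 1) γ)) =
      ∏ k : ZMod (m + 1), ((if k = 0 then ((m + 1 : ℕ) : ℝ) else 0) +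
        circulantSymbol γ (k.val / (m + 1 : ℕ))) := by
    rw [← Complex.ofReal_inj]
    push_cast at h ⊢
    rw [h]
    refine Finset.prod_congr rfl fun k _ => ?_
    split_ifs <;> simp
  have h'' := h'.trans (Fin.prod_univ_succ (n := m) fun k : Fin (m + 1) =>
    ((if k = 0 then ((m + 1 : ℕ) : ℝ) else 0) + circulantSymbol γ ((k : ℕ) / (m + 1 : ℕ))))
  have h0 : circulantSymbol γ 0 = 0 := by simp [circulantSymbol]
  simp only [if_true, Fin.val_zero, Nat.cast_zero, zero_div, h0, add_zero, Fin.succ_ne_zero,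
    if_false, zero_add, Fin.val_succ] at h''
  rw [← Fin.prod_univ_eq_prod_range
    (fun j => circulantSymbol γ ((j + 1 : ℕ) / (m + 1 : ℕ))) m]
  have hm : ((m + 1 : ℕ) : ℝ) ≠ 0 := Nat.cast_ne_zero.2 (Nat.succ_ne_zero m)
  apply mul_left_cancel₀ hm
  rw [← h'']
  ring

/-! ### Riemann sums -/

open Filter Topology

/-- Riemann sums of a continuous function over `n` intervals of length `1 / n`, evaluated at the
same relative position `σ` in each interval, converge to the integral. -/
theorem Continuous.tendsto_riemannSum {f : ℝ → ℝ} (hf : Continuous f) {σ : ℝ} (hσ : 0 ≤ σ)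
    (hσ' : σ ≤ 1) :
    Tendsto (fun n : ℕ => (∑ k ∈ Finset.range n, f ((k + σ) / n)) / n) atTop
      (𝓝 (∫ x in (0 : ℝ)..1, f x)) := by
  rw [Metric.tendsto_atTop]
  intro ε hε
  have huc := isCompact_Icc.uniformContinuousOn_of_continuous (s := Set.Icc (0 : ℝ) 1)
    hf.continuousOn
  rw [Metric.uniformContinuousOn_iff] at huc
  obtain ⟨δ, hδ, hfδ⟩ := huc (ε / 2) (half_pos hε)
  obtain ⟨N, hN⟩ := exists_nat_gt (1 / δ)
  refine ⟨N + 1, fun n hn => ?_⟩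
  have hn0 : (0 : ℝ) < n := by
    have : 0 < n := by omega
    exact_mod_cast this
  have hnδ : 1 / (n : ℝ) < δ := by
    rw [div_lt_comm₀ hn0 hδ]
    exact hN.trans_le (by exact_mod_cast (by omega : N ≤ n))
  have hint : ∫ x in (0 : ℝ)..1, f x =
      ∑ k ∈ Finset.range n, ∫ x in (k / n : ℝ)..((k + 1 : ℕ) / n), f x := by
    have := intervalIntegral.sum_integral_adjacent_intervals (f := f)
      (μ := MeasureTheory.volume) (a := fun k : ℕ => (k / n : ℝ)) (n := n)
      (fun k _ => hf.intervalIntegrable _ _)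
    rw [this]
    simp [hn0.ne']
  have hsum : (∑ k ∈ Finset.range n, f ((k + σ) / n)) / n =
      ∑ k ∈ Finset.range n, ∫ _ in (k / n : ℝ)..((k + 1 : ℕ) / n), f ((k + σ) / n) := by
    rw [Finset.sum_div]
    refine Finset.sum_congr rfl fun k _ => ?_
    rw [intervalIntegral.integral_const, smul_eq_mul]
    push_cast
    ring
  rw [dist_comm, Real.dist_eq, hint, hsum, ← Finset.sum_sub_distrib]
  have hterm : ∀ k ∈ Finset.range n,
      |(∫ x in (k / n : ℝ)..((k + 1 : ℕ) / n), f x) -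
        ∫ _ in (k / n : ℝ)..((k + 1 : ℕ) / n), f ((k + σ) / n)| ≤ ε / 2 * (1 / n) := by
    intro k hk
    have hk' : ((k + 1 : ℕ) : ℝ) ≤ n := by
      exact_mod_cast Finset.mem_range.1 hk
    push_cast at hk'
    have hlen : ((k + 1 : ℕ) / n : ℝ) - k / n = 1 / n := by
      push_cast
      ring
    rw [← intervalIntegral.integral_sub (hf.intervalIntegrable _ _) (by simp)]
    have hle : (k / n : ℝ) ≤ (k + 1 : ℕ) / n := by
      have : 0 < 1 / (n : ℝ) := by positivity
      linarith
    have := intervalIntegral.norm_integral_le_of_norm_le_const (a := (k / n : ℝ))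
      (b := (k + 1 : ℕ) / n) (C := ε / 2) (f := fun x => f x - f ((k + σ) / n)) fun x hx => by
        rw [Set.uIoc_of_le hle] at hx
        have h0 : (0 : ℝ) ≤ k / n := by positivity
        have h1 : ((k + 1 : ℕ) / n : ℝ) ≤ 1 := by
          rw [div_le_one hn0]
          exact_mod_cast hk'
        have h2 : (k / n : ℝ) ≤ (k + σ) / n := by gcongr; linarith
        have h3 : ((k + σ) / n : ℝ) ≤ (k + 1 : ℕ) / n := by push_cast; gcongr
        have hd : dist x ((k + σ) / n) < δ := by
          rw [Real.dist_eq, abs_lt]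
          constructor <;> linarith [hx.1, hx.2]
        exact (hfδ x ⟨h0.trans hx.1.le, hx.2.trans h1⟩ _ ⟨h0.trans h2, h3.trans h1⟩ hd).le
    rwa [hlen, abs_of_pos (by positivity : 0 < 1 / (n : ℝ))] at this
  calc _ ≤ ∑ k ∈ Finset.range n, ε / 2 * (1 / n) :=
        (Finset.abs_sum_le_sum_abs _ _).trans (Finset.sum_le_sum hterm)
    _ = ε / 2 := by
        rw [Finset.sum_const, Finset.card_range, nsmul_eq_mul]
        field_simp
    _ < ε := half_lt_self hε

/-! ### The eigenvalues of the cycle -/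

/-- The squared distance between `1` and `exp (2 π i x)`. -/
noncomputable def chordSq (x : ℝ) : ℝ := 2 - 2 * Real.cos (2 * Real.pi * x)

theorem circulantSymbol_eq_sum {d : ℕ} (γ : Fin d → ℕ) (x : ℝ) :
    circulantSymbol γ x = ∑ i, chordSq (γ i * x) := rfl

theorem chordSq_zero : chordSq 0 = 0 := by simp [chordSq]

theorem chordSq_nonneg (x : ℝ) : 0 ≤ chordSq x := by
  have := Real.cos_le_one (2 * Real.pi * x)
  rw [chordSq]
  linarith

theorem continuous_chordSq : Continuous chordSq := by
  unfold chordSq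
  fun_prop

theorem chordSq_add_nat (x : ℝ) (k : ℕ) : chordSq (x + k) = chordSq x := by
  rw [chordSq, chordSq, ← Real.cos_add_nat_mul_two_pi (2 * Real.pi * x) k]
  ring_nf

theorem chordSq_pos {x : ℝ} (h0 : 0 < x) (h1 : x < 1) : 0 < chordSq x := by
  have h : chordSq x = 4 * Real.sin (Real.pi * x) ^ 2 := by
    have := Real.cos_sq_add_sin_sq (Real.pi * x)
    rw [chordSq, mul_assoc, Real.cos_two_mul]
    linarith
  have := Real.sin_pos_of_pos_of_lt_pi (x := Real.pi * x) (by positivity)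
    (by nlinarith [Real.pi_pos])
  rw [h]
  positivity

theorem norm_sub_exp_sq (s x : ℝ) : ‖(s : ℂ) - Complex.exp (2 * Real.pi * x * Complex.I)‖ ^ 2 =
    1 + s ^ 2 - 2 * s * Real.cos (2 * Real.pi * x) := by
  have h : (2 * Real.pi * x * Complex.I : ℂ) = ((2 * Real.pi * x : ℝ) : ℂ) * Complex.I := by
    push_cast
    ring
  have := Real.cos_sq_add_sin_sq (2 * Real.pi * x)
  rw [Complex.sq_norm, Complex.normSq_apply, h, Complex.sub_re, Complex.sub_im,
    Complex.exp_ofReal_mul_I_re, Complex.exp_ofReal_mul_I_im, Complex.ofReal_re, Complex.ofReal_im]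
  linear_combination this

theorem chordSq_eq_norm_sq (x : ℝ) :
    chordSq x = ‖1 - Complex.exp (2 * Real.pi * x * Complex.I)‖ ^ 2 := by
  have := norm_sub_exp_sq 1 x
  rw [Complex.ofReal_one] at this
  rw [this, chordSq]
  ring

theorem prod_chordSq (m : ℕ) :
    ∏ j ∈ Finset.range m, chordSq ((j + 1 : ℕ) / (m + 1 : ℕ)) = ((m + 1 : ℕ) : ℝ) ^ 2 := by
  have h := (Complex.isPrimitiveRoot_exp (m + 1) (Nat.succ_ne_zero m)).prod_one_sub_pow_eq_order
  have h' := congrArg (fun z : ℂ => ‖z‖ ^ 2) h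
  simp only [norm_prod, ← Finset.prod_pow] at h'
  have hm : ‖(m : ℂ) + 1‖ = ((m + 1 : ℕ) : ℝ) := by
    rw [← Complex.norm_natCast]
    push_cast
    rfl
  rw [hm] at h'
  rw [← h']
  refine Finset.prod_congr rfl fun j _ => ?_
  rw [chordSq_eq_norm_sq, ← Complex.exp_nat_mul]
  congr 4
  push_cast
  ring

/-! ### Fixed generators -/

/-- The quotient of the symbol of the generators `1, δ 0, …` by the symbol of the generator `1`. -/
noncomputable def reducedSymbol {m : ℕ} (δ : Fin m → ℕ) (x : ℝ) : ℝ :=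
  1 + ∑ i, ‖∑ j ∈ Finset.range (δ i), Complex.exp (2 * Real.pi * x * Complex.I) ^ j‖ ^ 2

theorem one_le_reducedSymbol {m : ℕ} (δ : Fin m → ℕ) (x : ℝ) : 1 ≤ reducedSymbol δ x := by
  rw [reducedSymbol, le_add_iff_nonneg_right]
  exact Finset.sum_nonneg fun i _ => by positivity

theorem continuous_reducedSymbol {m : ℕ} (δ : Fin m → ℕ) : Continuous (reducedSymbol δ) := by
  unfold reducedSymbol
  fun_prop

theorem circulantSymbol_cons_one {m : ℕ} (δ : Fin m → ℕ) (x : ℝ) :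
    circulantSymbol (Fin.cons 1 δ : Fin (m + 1) → ℕ) x = chordSq x + circulantSymbol δ x := by
  simp [circulantSymbol_eq_sum, Fin.sum_univ_succ]

theorem circulantSymbol_cons_one_eq_mul {m : ℕ} (δ : Fin m → ℕ) (x : ℝ) :
    circulantSymbol (Fin.cons 1 δ : Fin (m + 1) → ℕ) x = chordSq x * reducedSymbol δ x := by
  rw [circulantSymbol_cons_one, reducedSymbol, mul_add, mul_one, Finset.mul_sum,
    circulantSymbol_eq_sum]
  congr 1
  refine Finset.sum_congr rfl fun i _ => ?_
  rw [chordSq_eq_norm_sq, chordSq_eq_norm_sq, ← mul_pow, ← norm_mul, mul_neg_geom_sum,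
    ← Complex.exp_nat_mul]
  congr 4
  push_cast
  ring

/-- The tree entropy of circulant graphs with fixed generators `1, δ 0, …`. -/
theorem isTreeEntropy_fixedCirculant {m : ℕ} (δ : Fin m → ℕ) :
    IsTreeEntropy (fixedCirculant δ) (∫ x in (0 : ℝ)..1, Real.log (reducedSymbol δ x)) := by
  have hpos : ∀ x, 0 < reducedSymbol δ x := fun x => one_pos.trans_le (one_le_reducedSymbol δ x)
  have hR := ((continuous_reducedSymbol δ).log fun x => (hpos x).ne').tendsto_riemannSum
    le_rfl zero_le_one
  have hlog : Tendsto (fun n : ℕ => Real.log n / n) atTop (𝓝 0) :=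
    (Real.isLittleO_log_id_atTop.tendsto_div_nhds_zero).comp tendsto_natCast_atTop_atTop
  have hconst : Tendsto (fun n : ℕ => Real.log (reducedSymbol δ 0) / n) atTop (𝓝 0) :=
    tendsto_const_nhds.div_atTop tendsto_natCast_atTop_atTop
  have := (hR.add hlog).sub hconst
  rw [add_zero, sub_zero] at this
  refine this.congr' ?_
  filter_upwards [eventually_ge_atTop 1] with n hn
  obtain ⟨l, rfl⟩ := Nat.exists_eq_add_of_le' hn
  have hcard : (Graph.vertexSet (fixedCirculant δ (l + 1))).ncard = l + 1 := by
    simp [fixedCirculant, circulant, Set.ncard_univ]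
  rw [hcard, ← add_div, ← sub_div]
  congr 1
  have hτ := spanningTreeCount_circulant_mul l (Fin.cons 1 δ)
  simp only [circulantSymbol_cons_one_eq_mul, Finset.prod_mul_distrib, prod_chordSq] at hτ
  have hl : ((l + 1 : ℕ) : ℝ) ≠ 0 := Nat.cast_ne_zero.2 (Nat.succ_ne_zero l)
  have hτ' : (spanningTreeCount (fixedCirculant δ (l + 1)) : ℝ) = ((l + 1 : ℕ) : ℝ) *
      ∏ j ∈ Finset.range l, reducedSymbol δ ((j + 1 : ℕ) / (l + 1 : ℕ)) := by
    apply mul_right_cancel₀ hl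
    rw [fixedCirculant, hτ]
    ring
  rw [hτ', Real.log_mul hl (Finset.prod_ne_zero_iff.2 fun j _ => (hpos _).ne'),
    Real.log_prod fun j _ => (hpos _).ne', Finset.sum_range_succ']
  simp
  ring

/-! ### The logarithmic mean -/

/-- The mean of `log (a + chordSq t)` over a period, in closed form. -/
noncomputable def logMean (a : ℝ) : ℝ := 2 * Real.arsinh (√a / 2)

theorem continuous_logMean : Continuous logMean :=
  continuous_const.mul (Real.continuous_arsinh.comp (Real.continuous_sqrt.div_const 2))

theorem logMean_zero : logMean 0 = 0 := by simp [logMean]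

theorem logMean_nonneg (a : ℝ) : 0 ≤ logMean a := by
  have : 0 ≤ Real.arsinh (√a / 2) := Real.arsinh_nonneg_iff.2 (by positivity)
  rw [logMean]
  positivity

/-- Jensen's formula: with `l = exp (logMean a)` one has `a = l + l⁻¹ - 2`, so
`a + chordSq t = |l - exp (2 π i t)|² / l`, and the mean of `log |l - z|` over the unit circle is
`log l` by the mean value property of harmonic functions. -/
theorem integral_log_add_chordSq {a : ℝ} (ha : 0 < a) :
    ∫ t in (0 : ℝ)..1, Real.log (a + chordSq t) = logMean a := by
  set l : ℝ := Real.exp (logMean a) with hl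
  have hu : 0 < Real.arsinh (√a / 2) := Real.arsinh_pos_iff.2 (by positivity)
  have hl1 : 1 < l := by
    rw [hl, Real.one_lt_exp_iff, logMean]
    positivity
  have hl0 : 0 < l := one_pos.trans hl1
  have hsinh : a * l = (l - 1) ^ 2 := by
    set w := Real.exp (Real.arsinh (√a / 2))
    have hw : 0 < w := Real.exp_pos _
    have hlw : l = w ^ 2 := by
      rw [hl, logMean, ← Real.exp_nat_mul]
      norm_num
    have h := Real.sinh_arsinh (√a / 2)
    rw [Real.sinh_eq, Real.exp_neg] at h
    have h2 : √a = w - w⁻¹ := by linarith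
    have h3 : a = (w - w⁻¹) ^ 2 := by rw [← h2, Real.sq_sqrt ha.le]
    rw [h3, hlw]
    field_simp
  have hne : ∀ t : ℝ, 0 < ‖Complex.exp (2 * Real.pi * t * Complex.I) - l‖ := by
    intro t
    rw [norm_pos_iff, sub_ne_zero]
    intro h
    have := congrArg norm h
    have h' : (2 * Real.pi * t * Complex.I : ℂ) = ((2 * Real.pi * t : ℝ) : ℂ) * Complex.I := by
      push_cast
      ring
    rw [h', Complex.norm_exp_ofReal_mul_I, Complex.norm_real, Real.norm_of_nonneg hl0.le] at this
    linarith
  have hpt : ∀ t : ℝ, Real.log (a + chordSq t) =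
      2 * Real.log ‖Complex.exp (2 * Real.pi * t * Complex.I) - l‖ - logMean a := by
    intro t
    have h1 := norm_sub_exp_sq l t
    rw [norm_sub_rev] at h1
    have h2 : a + chordSq t = ‖Complex.exp (2 * Real.pi * t * Complex.I) - l‖ ^ 2 / l := by
      rw [h1, eq_div_iff hl0.ne', add_mul, hsinh, chordSq]
      ring
    rw [h2, Real.log_div (pow_pos (hne t) 2).ne' hl0.ne', Real.log_pow, hl, Real.log_exp]
    norm_num
  have hcirc := circleAverage_log_norm_sub_const₂ (a := (l : ℂ))
    (by rwa [Complex.norm_real, Real.norm_of_nonneg hl0.le])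
  rw [Complex.norm_real, Real.norm_of_nonneg hl0.le, hl, Real.log_exp, ← hl,
    Real.circleAverage_def] at hcirc
  have hchange := intervalIntegral.integral_comp_mul_left (a := 0) (b := 1)
    (fun θ => Real.log ‖circleMap 0 1 θ - l‖) (c := 2 * Real.pi) (by positivity)
  rw [mul_zero, mul_one, hcirc] at hchange
  simp only [hpt]
  have hcont : Continuous fun t : ℝ =>
      Real.log ‖Complex.exp (2 * Real.pi * t * Complex.I) - l‖ :=
    Continuous.log (by fun_prop) fun t => (hne t).ne'
  rw [intervalIntegral.integral_sub ((hcont.const_mul 2).intervalIntegrable _ _) (by simp),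
    intervalIntegral.integral_const_mul]
  have heq : ∫ t in (0 : ℝ)..1, Real.log ‖Complex.exp (2 * Real.pi * t * Complex.I) - l‖ =
      logMean a := by
    rw [← hchange]
    simp [circleMap]
  rw [heq]
  simp
  ring

/-! ### Non-fixed generators -/

theorem Finset.sum_range_mul_eq {M : Type*} [AddCommMonoid M] (f : ℕ → M) (b n : ℕ) :
    ∑ j ∈ range (b * n), f j = ∑ c ∈ range b, ∑ k ∈ range n, f (c + b * k) := by
  rw [sum_comm]
  induction n with
  | zero => simp
  | succ n ih =>
    rw [mul_add, mul_one, sum_range_add, ih, sum_range_succ]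
    simp [add_comm]

theorem circulantSymbol_pos {m : ℕ} {δ : Fin m → ℕ} {i : Fin m} (hi : δ i = 1) {x : ℝ}
    (h0 : 0 < x) (h1 : x < 1) : 0 < circulantSymbol δ x := by
  rw [circulantSymbol_eq_sum]
  refine Finset.sum_pos' (fun j _ => chordSq_nonneg _) ⟨i, Finset.mem_univ i, ?_⟩
  rw [hi, Nat.cast_one, one_mul]
  exact chordSq_pos h0 h1

theorem circulantSymbol_nonneg {m : ℕ} (δ : Fin m → ℕ) (x : ℝ) : 0 ≤ circulantSymbol δ x :=
  Finset.sum_nonneg fun _ _ => chordSq_nonneg _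

theorem continuous_circulantSymbol {m : ℕ} (δ : Fin m → ℕ) : Continuous (circulantSymbol δ) := by
  unfold circulantSymbol
  fun_prop

/-- The sum includes the eigenvalue `0` at `j = 0`, which contributes `Real.log 0 = 0`. -/
theorem log_spanningTreeCount_circulant {m : ℕ} {δ : Fin m → ℕ} {i : Fin m} (hi : δ i = 1) {n : ℕ}
    (hn : n ≠ 0) : Real.log (spanningTreeCount (circulant n δ)) =
      ∑ j ∈ Finset.range n, Real.log (circulantSymbol δ (j / n)) - Real.log n := by
  obtain ⟨l, rfl⟩ := Nat.exists_eq_succ_of_ne_zero hn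
  have hτ := spanningTreeCount_circulant_mul l δ
  have hpos : ∀ j ∈ Finset.range l, circulantSymbol δ ((j + 1 : ℕ) / (l + 1 : ℕ)) ≠ 0 := by
    intro j hj
    refine (circulantSymbol_pos hi (by positivity) ?_).ne'
    rw [div_lt_one (by positivity)]
    exact_mod_cast Nat.succ_lt_succ (Finset.mem_range.1 hj)
  have hl : ((l + 1 : ℕ) : ℝ) ≠ 0 := Nat.cast_ne_zero.2 (Nat.succ_ne_zero l)
  have hτ0 : (spanningTreeCount (circulant (l + 1) δ) : ℝ) ≠ 0 := fun h => by
    rw [h, zero_mul] at hτ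
    exact Finset.prod_ne_zero_iff.2 hpos hτ.symm
  have hlog := congrArg Real.log hτ
  rw [Real.log_mul hτ0 hl, Real.log_prod hpos] at hlog
  rw [Nat.succ_eq_add_one, Finset.sum_range_succ', ← hlog]
  simp [circulantSymbol]

/-- The limit of the contribution of the eigenvalues with indices congruent to `c` modulo `β`. -/
theorem tendsto_sum_log_chordSq_add {c β : ℕ} (hc : c < β) {a : ℝ} (ha : c = 0 ∧ a = 0 ∨ 0 < a) :
    Tendsto (fun n : ℕ => (∑ k ∈ Finset.range n, Real.log (a + chordSq ((k + c / β) / n))) / n)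
      atTop (𝓝 (logMean a)) := by
  rcases ha with ⟨rfl, rfl⟩ | ha
  · have hlog : Tendsto (fun n : ℕ => 2 * (Real.log n / n)) atTop (𝓝 (2 * 0)) :=
      ((Real.isLittleO_log_id_atTop.tendsto_div_nhds_zero).comp
        tendsto_natCast_atTop_atTop).const_mul 2
    rw [logMean_zero, ← mul_zero (2 : ℝ)]
    refine hlog.congr' ?_
    filter_upwards [eventually_ge_atTop 1] with n hn
    obtain ⟨l, rfl⟩ := Nat.exists_eq_add_of_le' hn
    have h := congrArg Real.log (prod_chordSq l)
    rw [Real.log_pow, Real.log_prod fun j hj => (chordSq_pos (by positivity) (by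
      rw [div_lt_one (by positivity)]
      exact_mod_cast Nat.succ_lt_succ (Finset.mem_range.1 hj))).ne'] at h
    rw [Finset.sum_range_succ', ← mul_div_assoc]
    congr 1
    -- the term `k = 0` is `Real.log 0 = 0`
    push_cast at h ⊢
    simp [chordSq_zero, h]
  · rw [← integral_log_add_chordSq ha]
    have hβ : (0 : ℝ) < β := by exact_mod_cast (Nat.zero_le c).trans_lt hc
    exact (Continuous.log (continuous_const.add continuous_chordSq) fun t =>
      (add_pos_of_pos_of_nonneg ha (chordSq_nonneg t)).ne').tendsto_riemannSum (by positivity)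
      ((div_le_one hβ).2 (by exact_mod_cast hc.le))

/-- The tree entropy of circulant graphs with non-fixed generators. -/
theorem isTreeEntropy_nonFixedCirculant {m : ℕ} {δ : Fin m → ℕ} {i : Fin m} (hi : δ i = 1) {β : ℕ}
    (hβ : β ≠ 0) : IsTreeEntropy (nonFixedCirculant β δ)
      ((∑ c ∈ Finset.range β, logMean (circulantSymbol δ (c / β))) / β) := by
  have hβ' : (β : ℝ) ≠ 0 := Nat.cast_ne_zero.2 hβ
  have hlim := (tendsto_finsetSum (Finset.range β) fun c hc =>
    tendsto_sum_log_chordSq_add (Finset.mem_range.1 hc) (a := circulantSymbol δ (c / β)) (by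
      rcases Nat.eq_zero_or_pos c with rfl | hc0
      · exact Or.inl ⟨rfl, by simp [circulantSymbol]⟩
      · refine Or.inr (circulantSymbol_pos hi (by positivity) ?_)
        rw [div_lt_one (by positivity)]
        exact_mod_cast Finset.mem_range.1 hc)).div_const (β : ℝ)
  have hlog : Tendsto (fun n : ℕ => Real.log (β * n : ℕ) / (β * n : ℕ)) atTop (𝓝 0) :=
    (Real.isLittleO_log_id_atTop.tendsto_div_nhds_zero).comp
      (tendsto_natCast_atTop_atTop.comp (tendsto_id.const_mul_atTop' (Nat.pos_of_ne_zero hβ)))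
  have := hlim.sub hlog
  rw [sub_zero] at this
  refine this.congr' ?_
  filter_upwards [eventually_ge_atTop 1] with n hn
  have hn' : (n : ℝ) ≠ 0 := Nat.cast_ne_zero.2 (by omega)
  have hne : β * n ≠ 0 := Nat.mul_ne_zero hβ (by omega)
  have : NeZero (β * n) := ⟨hne⟩
  have hcard : (Graph.vertexSet (nonFixedCirculant β δ n)).ncard = β * n := by
    simp [nonFixedCirculant, circulant, Set.ncard_univ]
  have hsym : ∀ c k : ℕ, circulantSymbol (Fin.cons 1 fun i => δ i * n : Fin (m + 1) → ℕ)
      ((c + β * k : ℕ) / (β * n : ℕ)) =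
        circulantSymbol δ (c / β) + chordSq ((k + c / β) / n) := by
    intro c k
    rw [circulantSymbol_cons_one, add_comm, circulantSymbol_eq_sum, circulantSymbol_eq_sum]
    congr 1
    · refine Finset.sum_congr rfl fun i _ => ?_
      rw [← chordSq_add_nat (δ i * (c / β)) (δ i * k)]
      congr 1
      push_cast
      field_simp
    · congr 1
      push_cast
      field_simp
      ring
  rw [hcard, nonFixedCirculant,
    log_spanningTreeCount_circulant (i := 0) (by simp) hne, Finset.sum_range_mul_eq, sub_div]
  simp only [hsym]
  congr 1
  rw [← Finset.sum_div, div_div]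
  push_cast
  rw [mul_comm (n : ℝ)]

/-! ### Closed walks and moments -/

open MeasureTheory

/-- The end point of the walk with steps `± p i` in `ℤ` that starts at `0`. The step `(i, true)`
adds `p i` and the step `(i, false)` subtracts it. -/
def walkEnd {ι : Type*} {k : ℕ} (p : ι → ℤ) (w : Fin k → ι × Bool) : ℤ :=
  ∑ j, (if (w j).2 then 1 else -1) * p (w j).1

theorem sum_two_mul_cos_pow {ι : Type*} [Fintype ι] (θ : ι → ℝ) (k : ℕ) :
    (∑ i, 2 * Real.cos (θ i)) ^ k =
      ∑ w : Fin k → ι × Bool, Real.cos (∑ j, (if (w j).2 then 1 else -1) * θ (w j).1) := by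
  have hC : ((∑ i, 2 * Real.cos (θ i) : ℝ) : ℂ) =
      ∑ s : ι × Bool, Complex.exp (((if s.2 then 1 else -1) * θ s.1 : ℝ) * Complex.I) := by
    rw [Fintype.sum_prod_type, Complex.ofReal_sum]
    refine Finset.sum_congr rfl fun i _ => ?_
    rw [Fintype.sum_bool]
    push_cast
    rw [Complex.cos]
    simp
    ring
  have h := congrArg (fun z : ℂ => (z ^ k).re) hC
  rw [← Complex.ofReal_pow, Complex.ofReal_re] at h
  rw [h, Fintype.sum_pow, Complex.re_sum]
  refine Finset.sum_congr rfl fun w _ => ?_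
  rw [← Complex.exp_sum, ← Finset.sum_mul, ← Complex.ofReal_sum, Complex.exp_ofReal_mul_I_re]

/-- The sum over all steps of the characters of `ℤ × ℤ` at the point `(y, t)` of the torus, for the
walk with steps `± (p i, q i)`. -/
noncomputable def stepSum {ι : Type*} [Fintype ι] (p q : ι → ℤ) (y t : ℝ) : ℝ :=
  ∑ i, 2 * Real.cos (2 * Real.pi * (p i * y + q i * t))

theorem stepSum_pow {ι : Type*} [Fintype ι] (p q : ι → ℤ) (y t : ℝ) (k : ℕ) :
    stepSum p q y t ^ k = ∑ w : Fin k → ι × Bool,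
      Real.cos (2 * Real.pi * (walkEnd p w * y) + 2 * Real.pi * walkEnd q w * t) := by
  rw [stepSum, sum_two_mul_cos_pow]
  refine Finset.sum_congr rfl fun w _ => ?_
  congr 1
  rw [walkEnd, walkEnd, Int.cast_sum, Int.cast_sum, Finset.sum_mul, Finset.mul_sum, Finset.mul_sum,
    Finset.sum_mul, ← Finset.sum_add_distrib]
  refine Finset.sum_congr rfl fun j _ => ?_
  push_cast
  ring

theorem continuous_stepSum {ι : Type*} [Fintype ι] (p q : ι → ℤ) :
    Continuous fun z : ℝ × ℝ => stepSum p q z.1 z.2 := by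
  unfold stepSum
  fun_prop

theorem abs_stepSum_le {ι : Type*} [Fintype ι] (p q : ι → ℤ) (y t : ℝ) :
    |stepSum p q y t| ≤ 2 * Fintype.card ι := by
  refine (Finset.abs_sum_le_sum_abs _ _).trans ?_
  refine (Finset.sum_le_sum (g := fun _ => (2 : ℝ)) fun i _ => ?_).trans ?_
  · rw [abs_mul, abs_two]
    have := Real.abs_cos_le_one (2 * Real.pi * (p i * y + q i * t))
    linarith
  · simp [mul_comm]

theorem integral_cos_add_int_mul (α : ℝ) (m : ℤ) :
    ∫ t in (0 : ℝ)..1, Real.cos (α + 2 * Real.pi * m * t) = if m = 0 then Real.cos α else 0 := by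
  split_ifs with h
  · simp [h]
  · have hc : 2 * Real.pi * (m : ℝ) ≠ 0 :=
      mul_ne_zero (by positivity) (Int.cast_ne_zero.2 h)
    rw [intervalIntegral.integral_comp_add_mul (fun x => Real.cos x) hc, integral_cos, mul_one,
      mul_zero, add_zero, mul_comm (2 * Real.pi), Real.sin_add_int_mul_two_pi, sub_self, smul_zero]

/-- The moments of `stepSum` over the torus count the closed walks in `ℤ × ℤ`. -/
theorem integral_integral_stepSum_pow {ι : Type*} [Fintype ι] (p q : ι → ℤ) (k : ℕ) :
    ∫ y in (0 : ℝ)..1, ∫ t in (0 : ℝ)..1, stepSum p q y t ^ k =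
      (Nat.card {w : Fin k → ι × Bool // walkEnd p w = 0 ∧ walkEnd q w = 0} : ℝ) := by
  classical
  have h1 : ∀ y : ℝ, ∫ t in (0 : ℝ)..1, stepSum p q y t ^ k = ∑ w : Fin k → ι × Bool,
      if walkEnd q w = 0 then Real.cos (0 + 2 * Real.pi * walkEnd p w * y) else 0 := by
    intro y
    simp only [stepSum_pow]
    rw [intervalIntegral.integral_finsetSum fun w _ =>
      Continuous.intervalIntegrable (by fun_prop) _ _]
    refine Finset.sum_congr rfl fun w _ => ?_
    rw [integral_cos_add_int_mul, zero_add, mul_assoc (2 * Real.pi) (walkEnd p w : ℝ) y]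
  simp only [h1]
  rw [intervalIntegral.integral_finsetSum fun w _ => by
    split_ifs
    · exact Continuous.intervalIntegrable (by fun_prop) _ _
    · simp]
  rw [Nat.card_eq_fintype_card, Fintype.card_subtype, Finset.card_filter, Nat.cast_sum]
  refine Finset.sum_congr rfl fun w _ => ?_
  by_cases hq : walkEnd q w = 0
  · simp only [hq, if_true, integral_cos_add_int_mul, and_true]
    split_ifs <;> simp
  · simp [hq]

/-- The moments of `stepSum` over the closed curve `t = g y` count the walks in `ℤ × ℤ` whose
images under `(a, b) ↦ a + g b` are closed. -/
theorem integral_stepSum_line_pow {ι : Type*} [Fintype ι] (p q : ι → ℤ) (g k : ℕ) :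
    ∫ x in (0 : ℝ)..1, stepSum p q x (g * x) ^ k =
      (Nat.card {w : Fin k → ι × Bool // walkEnd p w + g * walkEnd q w = 0} : ℝ) := by
  classical
  simp only [stepSum_pow]
  have h1 : ∀ (w : Fin k → ι × Bool) (x : ℝ), Real.cos (2 * Real.pi * (walkEnd p w * x) +
      2 * Real.pi * walkEnd q w * (g * x)) =
      Real.cos (0 + 2 * Real.pi * (walkEnd p w + g * walkEnd q w : ℤ) * x) := by
    intro w x
    congr 1
    push_cast
    ring
  simp only [h1]
  rw [intervalIntegral.integral_finsetSum fun w _ =>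
    Continuous.intervalIntegrable (by fun_prop) _ _]
  rw [Nat.card_eq_fintype_card, Fintype.card_subtype, Finset.card_filter, Nat.cast_sum]
  refine Finset.sum_congr rfl fun w _ => ?_
  rw [integral_cos_add_int_mul]
  split_ifs <;> simp

theorem card_closedWalks_le {ι : Type*} [Fintype ι] (p q : ι → ℤ) (g k : ℕ) :
    Nat.card {w : Fin k → ι × Bool // walkEnd p w = 0 ∧ walkEnd q w = 0} ≤
      Nat.card {w : Fin k → ι × Bool // walkEnd p w + g * walkEnd q w = 0} :=
  Nat.card_mono (t := {w | walkEnd p w + g * walkEnd q w = 0}) (Set.toFinite _)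
    fun w hw => by simp [hw.1, hw.2]

/-- The walk with `g` steps `(1, 0)` and one step `(0, -1)` is closed in the quotient only. -/
theorem card_closedWalks_lt {ι : Type*} [Fintype ι] {p q : ι → ℤ} {i j : ι} (hpi : p i = 1)
    (hqi : q i = 0) (hpj : p j = 0) (hqj : q j = 1) (g : ℕ) :
    Nat.card {w : Fin (g + 1) → ι × Bool // walkEnd p w = 0 ∧ walkEnd q w = 0} <
      Nat.card {w : Fin (g + 1) → ι × Bool // walkEnd p w + g * walkEnd q w = 0} := by
  refine Set.ncard_lt_ncard (s := {w : Fin (g + 1) → ι × Bool | walkEnd p w = 0 ∧ walkEnd q w = 0})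
    (t := {w | walkEnd p w + g * walkEnd q w = 0}) ⟨fun w hw => ?_, fun h => ?_⟩ (Set.toFinite _)
  · simp [hw.1, hw.2]
  · have hp : walkEnd p (Fin.cons (j, false) fun _ => (i, true) : Fin (g + 1) → ι × Bool) = g := by
      simp [walkEnd, Fin.sum_univ_succ, hpi, hpj]
    have hq : walkEnd q (Fin.cons (j, false) fun _ => (i, true) : Fin (g + 1) → ι × Bool) = -1 := by
      simp [walkEnd, Fin.sum_univ_succ, hqi, hqj]
    have := (h (show _ = _ by rw [hp, hq]; ring)).2
    rw [hq] at this
    norm_num at this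

/-! ### Power series expansion of the logarithmic integrals -/

section
variable {X : Type*} [MeasurableSpace X] {μ : Measure X} [IsProbabilityMeasure μ] {f : X → ℝ}
  {M R : ℝ}

theorem integrable_log_sub (hf : AEStronglyMeasurable f μ) (hM : ∀ x, |f x| ≤ M) (hR : M < R) :
    Integrable (fun x => Real.log (R - f x)) μ := by
  refine Integrable.of_bound (C := max |Real.log (R - M)| |Real.log (R + M)|) ?_
    (Eventually.of_forall fun x => ?_)
  · exact (Real.measurable_log.comp_aemeasurable
      (aemeasurable_const.sub hf.aemeasurable)).aestronglyMeasurable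
  · have := abs_le.1 (hM x)
    exact abs_le_max_abs_abs (Real.log_le_log (by linarith) (by linarith))
      (Real.log_le_log (by linarith) (by linarith))

/-- The expansion of the mean of `log (R - f)` in terms of the moments of `f`. -/
theorem hasSum_moments (hf : AEStronglyMeasurable f μ) (hM : ∀ x, |f x| ≤ M) (hR : M < R) :
    HasSum (fun k : ℕ => (∫ x, f x ^ (k + 1) ∂μ) / (R ^ (k + 1) * (k + 1)))
      (Real.log R - ∫ x, Real.log (R - f x) ∂μ) := by
  have hX : Nonempty X := by
    by_contra h
    rw [not_nonempty_iff] at h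
    exact IsProbabilityMeasure.ne_zero μ (Measure.eq_zero_of_isEmpty μ)
  have hM0 : 0 ≤ M := (abs_nonneg _).trans (hM hX.some)
  have hR0 : 0 < R := hM0.trans_lt hR
  have hr1 : M / R < 1 := (div_lt_one hR0).2 hR
  have hr0 : 0 ≤ M / R := by positivity
  have hfr : ∀ x, |f x / R| ≤ M / R := fun x => by
    rw [abs_div, abs_of_pos hR0]
    exact div_le_div_of_nonneg_right (hM x) hR0.le
  have hsumm : Summable fun k : ℕ => (M / R) ^ (k + 1) :=
    (summable_nat_add_iff 1).2 (summable_geometric_of_lt_one hr0 hr1)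
  have h := hasSum_integral_of_dominated_convergence (μ := μ)
    (F := fun (k : ℕ) x => (f x / R) ^ (k + 1) / (k + 1))
    (f := fun x => Real.log R - Real.log (R - f x)) (fun k _ => (M / R) ^ (k + 1))
    (fun k => (((hf.aemeasurable.div_const R).pow_const (k + 1)).div_const _).aestronglyMeasurable)
    (fun k => Eventually.of_forall fun x => by
      rw [Real.norm_eq_abs, abs_div, abs_pow, abs_of_pos (by positivity : (0 : ℝ) < k + 1)]
      refine (div_le_self (by positivity)
        (by linarith [(Nat.cast_nonneg k : (0 : ℝ) ≤ k)])).trans ?_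
      exact pow_le_pow_left₀ (abs_nonneg _) (hfr x) _)
    (Eventually.of_forall fun _ => hsumm) (integrable_const _)
    (Eventually.of_forall fun x => by
      have hx := Real.hasSum_pow_div_log_of_abs_lt_one ((hfr x).trans_lt hr1)
      have hpos : 0 < R - f x := by linarith [(abs_le.1 (hM x)).2]
      have : -Real.log (1 - f x / R) = Real.log R - Real.log (R - f x) := by
        rw [one_sub_div hR0.ne', Real.log_div hpos.ne' hR0.ne']
        ring
      rwa [this] at hx)
  rw [integral_sub (integrable_const _) (integrable_log_sub hf hM hR), integral_const] at h
  simp only [probReal_univ, one_smul] at h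
  refine h.congr_fun ?_
  intro k
  rw [← integral_div]
  congr 1
  ext x
  rw [div_pow, div_div]

end

/-- Passing from `ℤ × ℤ` to its quotient `ℤ` by `(a, b) ↦ a + g b` decreases the mean of
`log (R - stepSum)` by an amount that is bounded below uniformly in `R`. -/
theorem integral_log_stepSum_line_le {ι : Type*} [Fintype ι] {p q : ι → ℤ} {i j : ι}
    (hpi : p i = 1) (hqi : q i = 0) (hpj : p j = 0) (hqj : q j = 1) (g : ℕ) {R R' : ℝ}
    (hR : 2 * Fintype.card ι < R) (hR' : R ≤ R') :
    (∫ x in (0 : ℝ)..1, Real.log (R - stepSum p q x (g * x))) + 1 / (R' ^ (g + 1) * (g + 1)) ≤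
      ∫ y in (0 : ℝ)..1, ∫ t in (0 : ℝ)..1, Real.log (R - stepSum p q y t) := by
  have hR0 : 0 < R := lt_of_le_of_lt (by positivity) hR
  have hprob : IsProbabilityMeasure (volume.restrict (Set.Ioc (0 : ℝ) 1)) := ⟨by simp⟩
  have h1 := hasSum_moments (μ := volume.restrict (Set.Ioc (0 : ℝ) 1))
    (f := fun x => stepSum p q x (g * x))
    ((continuous_stepSum p q).comp
      (by fun_prop : Continuous fun x : ℝ => (x, g * x))).aestronglyMeasurable
    (fun x => abs_stepSum_le p q _ _) hR
  have hmeas : AEStronglyMeasurable (fun z : ℝ × ℝ => stepSum p q z.1 z.2)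
      ((volume.restrict (Set.Ioc (0 : ℝ) 1)).prod (volume.restrict (Set.Ioc (0 : ℝ) 1))) :=
    (continuous_stepSum p q).aestronglyMeasurable
  have h2 := hasSum_moments hmeas (fun x => abs_stepSum_le p q _ _) hR
  rw [integral_prod _ (integrable_log_sub hmeas (fun x => abs_stepSum_le p q _ _) hR)] at h2
  have hpow : ∀ k : ℕ, ∫ z, stepSum p q z.1 z.2 ^ k
      ∂((volume.restrict (Set.Ioc (0 : ℝ) 1)).prod (volume.restrict (Set.Ioc (0 : ℝ) 1))) =
      (Nat.card {w : Fin k → ι × Bool // walkEnd p w = 0 ∧ walkEnd q w = 0} : ℝ) := by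
    intro k
    rw [integral_prod, ← integral_integral_stepSum_pow]
    · simp only [intervalIntegral.integral_of_le zero_le_one]
    · refine Integrable.of_bound (C := (2 * Fintype.card ι : ℝ) ^ k)
        ((continuous_stepSum p q).pow k).aestronglyMeasurable (Eventually.of_forall fun z => ?_)
      rw [Real.norm_eq_abs, abs_pow]
      exact pow_le_pow_left₀ (abs_nonneg _) (abs_stepSum_le p q _ _) _
  simp only [hpow] at h2
  simp only [← intervalIntegral.integral_of_le (zero_le_one' ℝ), integral_stepSum_line_pow] at h1 h2
  have h := h1.sub h2
  have hle := le_hasSum h g fun k _ => by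
    rw [← sub_div]
    have : (Nat.card {w : Fin (k + 1) → ι × Bool // walkEnd p w = 0 ∧ walkEnd q w = 0} : ℝ) ≤
        Nat.card {w : Fin (k + 1) → ι × Bool // walkEnd p w + g * walkEnd q w = 0} := by
      exact_mod_cast card_closedWalks_le p q g (k + 1)
    exact div_nonneg (sub_nonneg.2 this) (by positivity)
  have hlt : (1 : ℝ) ≤ (Nat.card {w : Fin (g + 1) → ι × Bool //
      walkEnd p w + g * walkEnd q w = 0} : ℝ) -
      Nat.card {w : Fin (g + 1) → ι × Bool // walkEnd p w = 0 ∧ walkEnd q w = 0} := by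
    rw [le_sub_iff_add_le']
    exact_mod_cast card_closedWalks_lt hpi hqi hpj hqj g
  rw [← sub_div] at hle
  have hgap : 1 / (R' ^ (g + 1) * (g + 1)) ≤ ((Nat.card {w : Fin (g + 1) → ι × Bool //
      walkEnd p w + g * walkEnd q w = 0} : ℝ) -
      Nat.card {w : Fin (g + 1) → ι × Bool // walkEnd p w = 0 ∧ walkEnd q w = 0}) /
        (R ^ (g + 1) * (g + 1)) := by
    gcongr
  linarith

/-! ### Comparison of the entropies -/

/-- The mean of `log` of the regularized symbol of the generators `δ 0, δ 1, …, g` of `ℤ` is smaller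
than that of the generators `(δ 0, 0), (δ 1, 0), …, (0, 1)` of `ℤ × ℤ`; on the right, the mean over
the second variable is already taken. -/
theorem integral_log_add_circulantSymbol_le {m : ℕ} {δ : Fin m → ℕ} {i₀ : Fin m} (hi : δ i₀ = 1)
    (g : ℕ) {ε : ℝ} (hε : 0 < ε) (hε1 : ε ≤ 1) :
    (∫ x in (0 : ℝ)..1, Real.log (ε + (circulantSymbol δ x + chordSq (g * x)))) +
        1 / ((2 * (m + 1) + 1 : ℝ) ^ (g + 1) * (g + 1)) ≤
      ∫ y in (0 : ℝ)..1, logMean (ε + circulantSymbol δ y) := by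
  let p : Option (Fin m) → ℤ := fun i => i.elim 0 fun i => δ i
  let q : Option (Fin m) → ℤ := fun i => i.elim 1 fun _ => 0
  have hstep : ∀ y t : ℝ, 2 * (m + 1) + ε - stepSum p q y t =
      ε + circulantSymbol δ y + chordSq t := by
    intro y t
    rw [stepSum, Fintype.sum_option, circulantSymbol, chordSq, Finset.sum_sub_distrib]
    simp [p, q]
    ring
  have h := integral_log_stepSum_line_le (p := p) (q := q) (i := some i₀) (j := none)
    (by simp [p, hi]) rfl rfl rfl g (R := 2 * (m + 1) + ε) (R' := 2 * (m + 1) + 1)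
    (by simpa using hε) (by linarith)
  have hinner : ∀ y : ℝ, ∫ t in (0 : ℝ)..1, Real.log (ε + circulantSymbol δ y + chordSq t) =
      logMean (ε + circulantSymbol δ y) := fun y =>
    integral_log_add_chordSq (add_pos_of_pos_of_nonneg hε (circulantSymbol_nonneg δ y))
  simp only [hstep, hinner] at h
  simp only [← add_assoc]
  exact h

/-- A regularization of the entropy of circulant graphs with fixed generators bounds it from above:
if `H` is an upper bound of `reducedSymbol γ`, then
`reducedSymbol γ * (chordSq + ε / H) ≤ circulantSymbol + ε`, and the mean of
`log (chordSq + ε / H)` is nonnegative. -/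
theorem integral_log_reducedSymbol_le {m : ℕ} (γ : Fin m → ℕ) {ε : ℝ} (hε : 0 < ε) :
    ∫ x in (0 : ℝ)..1, Real.log (reducedSymbol γ x) ≤
      ∫ x in (0 : ℝ)..1,
        Real.log (ε + circulantSymbol (Fin.cons 1 γ : Fin (m + 1) → ℕ) x) := by
  have hpos : ∀ x, 0 < reducedSymbol γ x := fun x => one_pos.trans_le (one_le_reducedSymbol γ x)
  obtain ⟨H, hH⟩ := isCompact_Icc.exists_bound_of_continuousOn (s := Set.Icc (0 : ℝ) 1)
    (continuous_reducedSymbol γ).continuousOn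
  have hH0 : 0 < H := (hpos 0).trans_le ((le_abs_self _).trans (hH 0 (by simp)))
  have hεH : 0 < ε / H := by positivity
  have hcont1 : Continuous fun x => Real.log (reducedSymbol γ x) :=
    (continuous_reducedSymbol γ).log fun x => (hpos x).ne'
  have hcont2 : Continuous fun x => Real.log (ε / H + chordSq x) :=
    (continuous_const.add continuous_chordSq).log fun x =>
      (add_pos_of_pos_of_nonneg hεH (chordSq_nonneg x)).ne'
  have hcont3 : Continuous fun x =>
      Real.log (ε + circulantSymbol (Fin.cons 1 γ : Fin (m + 1) → ℕ) x) :=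
    (continuous_const.add (continuous_circulantSymbol _)).log fun x =>
      (add_pos_of_pos_of_nonneg hε (circulantSymbol_nonneg _ x)).ne'
  calc ∫ x in (0 : ℝ)..1, Real.log (reducedSymbol γ x)
      ≤ (∫ x in (0 : ℝ)..1, Real.log (reducedSymbol γ x)) + logMean (ε / H) :=
        le_add_of_nonneg_right (logMean_nonneg _)
    _ = ∫ x in (0 : ℝ)..1, (Real.log (reducedSymbol γ x) + Real.log (ε / H + chordSq x)) := by
        rw [← integral_log_add_chordSq hεH, intervalIntegral.integral_add
          (hcont1.intervalIntegrable _ _) (hcont2.intervalIntegrable _ _)]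
    _ ≤ _ := by
        refine intervalIntegral.integral_mono_on zero_le_one
          ((hcont1.add hcont2).intervalIntegrable _ _) (hcont3.intervalIntegrable _ _)
          fun x hx => ?_
        have h2 : 0 < ε / H + chordSq x := add_pos_of_pos_of_nonneg hεH (chordSq_nonneg x)
        rw [← Real.log_mul (hpos x).ne' h2.ne']
        refine Real.log_le_log (mul_pos (hpos x) h2) ?_
        rw [circulantSymbol_cons_one_eq_mul, mul_add, mul_comm (chordSq x)]
        gcongr
        rw [mul_div_assoc', div_le_iff₀ hH0, mul_comm]
        gcongr
        exact (le_abs_self _).trans (hH x hx)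

/-- The entropy for the fixed generators `1, γ 0, …, γ d` is smaller than the limit, as `β → ∞`, of
the entropy for the non-fixed generators. -/
theorem integral_log_reducedSymbol_lt {d : ℕ} (γ : Fin (d + 1) → ℕ) :
    ∫ x in (0 : ℝ)..1, Real.log (reducedSymbol γ x) <
      ∫ y in (0 : ℝ)..1, logMean
        (circulantSymbol (Fin.cons 1 fun i : Fin d => γ i.castSucc : Fin (d + 1) → ℕ) y) := by
  set δ : Fin (d + 1) → ℕ := Fin.cons 1 fun i : Fin d => γ i.castSucc
  set g := γ (Fin.last d)
  have hsplit : ∀ x, circulantSymbol (Fin.cons 1 γ : Fin (d + 2) → ℕ) x =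
      circulantSymbol δ x + chordSq (g * x) := by
    intro x
    rw [circulantSymbol_cons_one, circulantSymbol_cons_one, circulantSymbol_eq_sum,
      circulantSymbol_eq_sum, Fin.sum_univ_castSucc, add_assoc]
  set η : ℝ := 1 / ((2 * ((d + 1 : ℕ) + 1) + 1 : ℝ) ^ (g + 1) * (g + 1)) with hη
  have hη0 : 0 < η := by positivity
  have hle : ∀ ε ∈ Set.Ioc (0 : ℝ) 1, (∫ x in (0 : ℝ)..1, Real.log (reducedSymbol γ x)) + η ≤
      ∫ y in (0 : ℝ)..1, logMean (ε + circulantSymbol δ y) := by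
    intro ε hε
    have h1 := integral_log_reducedSymbol_le γ hε.1
    have h2 := integral_log_add_circulantSymbol_le (δ := δ) (i₀ := 0) rfl g hε.1 hε.2
    simp only [hsplit] at h1
    linarith
  have hcont : Continuous fun ε : ℝ => ∫ y in (0 : ℝ)..1, logMean (ε + circulantSymbol δ y) := by
    refine intervalIntegral.continuous_parametric_intervalIntegral_of_continuous'
      (f := fun ε y => logMean (ε + circulantSymbol δ y)) ?_ 0 1
    exact continuous_logMean.comp
      (continuous_fst.add ((continuous_circulantSymbol δ).comp continuous_snd))
  have hlim := (hcont.tendsto 0).mono_left (nhdsWithin_le_nhds (s := Set.Ioi 0))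
  simp only [zero_add] at hlim
  have := ge_of_tendsto hlim (Filter.mem_of_superset (Ioc_mem_nhdsGT one_pos) hle)
  linarith

/-- The `d + 1` given positive integers are `γ 0, …, γ d`; the non-fixed generators are
`1, n, γ 0 * n, …, γ (d - 1) * n` on `β * n` vertices and the fixed ones are `1, γ 0, …, γ d`. -/
theorem mainTheorem4 (d : ℕ) (γ : Fin (d + 1) → ℕ) (hγ : ∀ i, 0 < γ i) :
    ∃ zF : ℝ, IsTreeEntropy (fixedCirculant γ) zF ∧
      ∃ B : ℕ, 2 ≤ B ∧ ∀ β : ℕ, B ≤ β →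
        ∃ zNF : ℝ,
          IsTreeEntropy (nonFixedCirculant β (Fin.cons 1 (fun i : Fin d => γ i.castSucc))) zNF ∧
            zF < zNF := by
  have hlim := (continuous_logMean.comp (continuous_circulantSymbol
    (Fin.cons 1 fun i : Fin d => γ i.castSucc : Fin (d + 1) → ℕ))).tendsto_riemannSum le_rfl
      zero_le_one
  obtain ⟨B, hB⟩ := eventually_atTop.1
    (hlim.eventually (lt_mem_nhds (integral_log_reducedSymbol_lt γ)))
  refine ⟨_, isTreeEntropy_fixedCirculant γ, max 2 B, le_max_left _ _, fun β hβ => ?_⟩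
  refine ⟨_, isTreeEntropy_nonFixedCirculant (i := 0) rfl
    (by have := (le_max_left 2 B).trans hβ; omega), ?_⟩
  simpa using hB β ((le_max_right _ _).trans hβ)
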